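/- Let $\Omega\subset\mathbb{R}^d$ be compact and convex, let $\mathcal{P}(\Omega)$ be the set of Borel probability measures on $\Omega$ with the weak topology, $\mathcal{P}_2(\mathbb{R}^d)$ the set of Borel probability measures on $\mathbb{R}^d$ with finite second moment, and $W_2$ the $L^2$-Wasserstein distance. Let $\mathcal{E}:\mathcal{P}(\Omega)\to(-\infty,+\infty]$ be lower semicontinuous, $\rho_0\in\mathcal{P}(\Omega)$ with $\mathcal{E}(\rho_0)<\infty$, and let $0\le\beta<1$ (with $\alpha=1+\beta$), $0\le\theta<\tfrac12$ and $C>0$. Then there is a constant $K$, depending only on $\Omega$, $\mathcal{E}$, $\rho_0$, $\beta$, $\theta$ and $C$, such that the following holds. Let $T>0$ and let $\mathsf{E}_\alpha:\mathcal{P}_2(\mathbb{R}^d)\times\mathcal{P}_2(\mathbb{R}^d)\to\mathcal{P}_2(\mathbb{R}^d)$ be $\theta$-dissipative, i.e. $W_2(\mu_1,\mathsf{E}_\alpha(\mu_0,\mu_1))\le\theta\,W_2(\mu_0,\mu_1)$ for all $\mu_0,\mu_1\in\mathcal{P}_2(\mathbb{R}^d)$. For every $N\ge1$, with $\tau=T/N$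 and $t_n=n\tau$, let $\rho_1=\rho_1^N\in\mathcal{P}(\Omega)$ satisfy $W_2^2(\rho_0,\rho_1)\le C\tau$ and $\mathcal{E}(\rho_1)\le\mathcal{E}(\rho_0)$, and let $\rho_2,\dots,\rho_N\in\mathcal{P}(\Omega)$ (depending on $N$) be given by the EVBDF2 scheme $$\rho_n\in\operatorname*{argmin}_{\rho\in\mathcal{P}(\Omega)}\ \frac{W_2^2\big(\rho,\mathsf{E}_\alpha(\rho_{n-2},\rho_{n-1})\big)}{2(1-\beta)\tau}+\mathcal{E}(\rho),\qquad 2\le n\le N.$$ Let $\rho_\tau:[0,T]\to\mathcal{P}(\Omega)$ be the piecewise constant curve with $\rho_\tau(0)=\rho_0$ and $\rho_\tau(t)=\rho_{n-1}$ for $t\in(t_{n-1},t_n]$, $1\le n\le N$. Then: 1. Every subsequence of $(\rho_{T/N})_{N\ge1}$ has a further subsequence which converges, uniformly on $[0,T]$ in the $W_2$ distance, to a curve $\varrho:[0,T]\to\mathcal{P}(\Omega)$ that is absolutely continuous with respect to $W_2$ (there is $m\in L^1(0,T)$ with $W_2(\varrho(s),\varrho(t))\le\int_s^t m(r)\,\mathrm{d}r$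 for $0\le s\le t\le T$) and $\tfrac12$-Hölder: $W_2(\varrho(s),\varrho(t))\le K|t-s|^{1/2}$ for all $s,t\in[0,T]$. 2. For every $N\ge1$ and every curve $\tilde\rho_\tau:[0,T]\to\mathcal{P}_2(\mathbb{R}^d)$ which on each $[t_{n-1},t_n]$, $1\le n\le N$, is a constant speed $W_2$-geodesic from $\rho_{n-1}$ to $\rho_n$, one has $W_2(\rho_\tau(t),\tilde\rho_\tau(t))\le K\sqrt{\tau}$ for all $t\in[0,T]$. -/

import Mathlib

open MeasureTheory Set Filter Topology
open scoped ENNReal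

noncomputable section

namespace EVBDF2

/-- Euclidean space `ℝ^d`. -/
abbrev Space (d : ℕ) : Type := EuclideanSpace ℝ (Fin d)

/-- `P₂(ℝ^d)`: Borel probability measures on `ℝ^d` with finite second moment. -/
abbrev P2 (d : ℕ) : Type :=
  {μ : ProbabilityMeasure (Space d) // ∫⁻ x, ‖x‖ₑ ^ 2 ∂(μ : Measure (Space d)) < ∞}

/-- `P(Ω)`: Borel probability measures on `ℝ^d` concentrated on `Ω`, with the topology of weak
convergence (inherited from `ProbabilityMeasure`). -/
abbrev POn {d : ℕ} (Ω : Set (Space d)) : Type :=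
  {μ : ProbabilityMeasure (Space d) // (μ : Measure (Space d)) Ωᶜ = 0}

/-- For compact `Ω`, the inclusion `P(Ω) ⊆ P₂(ℝ^d)`. -/
def POn.toP2 {d : ℕ} {Ω : Set (Space d)} (hΩ : IsCompact Ω) (μ : POn Ω) : P2 d :=
  ⟨μ.1, by
    obtain ⟨R, hR⟩ := hΩ.isBounded.exists_norm_le
    have hae : ∀ᵐ x ∂(μ.1 : Measure (Space d)), ‖x‖ₑ ^ 2 ≤ ENNReal.ofReal R ^ 2 := by
      have h : ∀ᵐ x ∂(μ.1 : Measure (Space d)), x ∈ Ω := μ.2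
      filter_upwards [h] with x hx
      gcongr
      rw [← ofReal_norm]
      exact ENNReal.ofReal_le_ofReal (hR x hx)
    refine (lintegral_mono_ae hae).trans_lt ?_
    rw [lintegral_const, measure_univ, mul_one]
    exact ENNReal.pow_lt_top ENNReal.ofReal_lt_top⟩

/-- `Π(μ, ν)`: measures on `ℝ^d × ℝ^d` with marginals `μ` and `ν`. -/
def couplings {d : ℕ} (μ ν : ProbabilityMeasure (Space d)) : Set (Measure (Space d × Space d)) :=
  {γ | γ.map Prod.fst = μ ∧ γ.map Prod.snd = ν}

/-- The squared `L²`-Wasserstein distance, with values in `[0, ∞]`. -/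
def W2sq {d : ℕ} (μ ν : ProbabilityMeasure (Space d)) : ℝ≥0∞ :=
  ⨅ γ ∈ couplings μ ν, ∫⁻ p, ‖p.1 - p.2‖ₑ ^ 2 ∂γ

/-- The `L²`-Wasserstein distance as a real number; it is only used between measures with finite
second moment, for which `W2sq` is finite (see `W2sq_lt_top`). -/
def W2 {d : ℕ} (μ ν : ProbabilityMeasure (Space d)) : ℝ :=
  Real.sqrt (W2sq μ ν).toReal

theorem W2sq_lt_top {d : ℕ} (μ ν : P2 d) : W2sq μ.1 ν.1 < ∞ := by
  have hmem : (μ.1 : Measure (Space d)).prod (ν.1 : Measure (Space d)) ∈ couplings μ.1 ν.1 := by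
    constructor <;> simp
  refine (iInf₂_le _ hmem).trans_lt ?_
  have hle : ∀ p : Space d × Space d,
      ‖p.1 - p.2‖ₑ ^ 2 ≤ 2 * (‖p.1‖ₑ ^ 2) + 2 * (‖p.2‖ₑ ^ 2) := by
    intro p
    have h1 : ‖p.1 - p.2‖₊ ^ 2 ≤ 2 * ‖p.1‖₊ ^ 2 + 2 * ‖p.2‖₊ ^ 2 := by
      rw [← NNReal.coe_le_coe]
      push_cast
      nlinarith [norm_sub_le p.1 p.2, norm_nonneg (p.1 - p.2), norm_nonneg p.1,
        norm_nonneg p.2, sq_nonneg (‖p.1‖ - ‖p.2‖)]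
    simp only [enorm_eq_nnnorm]
    exact_mod_cast h1
  refine (lintegral_mono hle).trans_lt ?_
  rw [lintegral_add_left (by fun_prop), lintegral_const_mul _ (by fun_prop),
    lintegral_const_mul _ (by fun_prop)]
  have e1 : ∫⁻ p : Space d × Space d, ‖p.1‖ₑ ^ 2
      ∂((μ.1 : Measure (Space d)).prod (ν.1 : Measure (Space d))) < ∞ := by
    rw [lintegral_prod _ (by fun_prop)]
    simpa using μ.2
  have e2 : ∫⁻ p : Space d × Space d, ‖p.2‖ₑ ^ 2
      ∂((μ.1 : Measure (Space d)).prod (ν.1 : Measure (Space d))) < ∞ := by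
    rw [lintegral_prod _ (by fun_prop)]
    simpa using ν.2
  exact ENNReal.add_lt_top.2 ⟨ENNReal.mul_lt_top (by simp) e1, ENNReal.mul_lt_top (by simp) e2⟩

/-- A map `P₂(ℝ^d) × P₂(ℝ^d) → P₂(ℝ^d)` is a `θ`-dissipative extrapolation if
`W₂(μ₁, X(μ₀, μ₁)) ≤ θ W₂(μ₀, μ₁)` for all `μ₀, μ₁`. -/
def IsDissipative {d : ℕ} (X : P2 d → P2 d → P2 d) (θ : ℝ) : Prop :=
  0 ≤ θ ∧ ∀ μ₀ μ₁ : P2 d, W2 μ₁.1 (X μ₀ μ₁).1 ≤ θ * W2 μ₀.1 μ₁.1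

/-- `ρ 0, …, ρ N` is a discrete solution of the EVBDF2 scheme with energy `𝓔`, extrapolation
operator `X`, parameter `β = α - 1` and time step `τ`: for `2 ≤ n ≤ N`, the measure `ρ n` minimizes
`σ ↦ W₂²(σ, X(ρ (n-2), ρ (n-1))) / (2 (1 - β) τ) + 𝓔 σ` over `P(Ω)`. -/
def IsSchemeSolution {d : ℕ} {Ω : Set (Space d)} (hΩ : IsCompact Ω) (𝓔 : POn Ω → EReal)
    (X : P2 d → P2 d → P2 d) (β τ : ℝ) (N : ℕ) (ρ : ℕ → POn Ω) : Prop :=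
  ∀ n : ℕ, n + 2 ≤ N → ∀ σ : POn Ω,
    ((W2 (ρ (n + 2)).1 (X ((ρ n).toP2 hΩ) ((ρ (n + 1)).toP2 hΩ)).1 ^ 2
        / (2 * (1 - β) * τ) : ℝ) : EReal) + 𝓔 (ρ (n + 2))
      ≤ ((W2 σ.1 (X ((ρ n).toP2 hΩ) ((ρ (n + 1)).toP2 hΩ)).1 ^ 2
        / (2 * (1 - β) * τ) : ℝ) : EReal) + 𝓔 σ

/-- The piecewise constant curve: `ρ 0` at time `0` and `ρ (n - 1)` on `((n - 1) τ, n τ]`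
for `n ≥ 1` (see `piecewiseConst_zero` and `piecewiseConst_of_mem`). -/
def piecewiseConst {A : Type*} (τ : ℝ) (ρ : ℕ → A) (t : ℝ) : A :=
  ρ (⌈t / τ⌉₊ - 1)

theorem piecewiseConst_zero {A : Type*} (τ : ℝ) (ρ : ℕ → A) : piecewiseConst τ ρ 0 = ρ 0 := by
  simp [piecewiseConst]

theorem piecewiseConst_of_mem {A : Type*} {τ : ℝ} (hτ : 0 < τ) (ρ : ℕ → A) (n : ℕ) {t : ℝ}
    (ht : t ∈ Ioc (n * τ) ((n + 1) * τ)) : piecewiseConst τ ρ t = ρ n := by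
  have h : ⌈t / τ⌉₊ = n + 1 := by
    rw [Nat.ceil_eq_iff (Nat.succ_ne_zero n)]
    refine ⟨?_, ?_⟩
    · rw [lt_div_iff₀ hτ]
      simpa using ht.1
    · rw [div_le_iff₀ hτ]
      simpa using ht.2
  simp [piecewiseConst, h]

/-- `ω` restricted to `[t₀, t₁]` is a (globally length-minimizing, constant speed) geodesic of
the Wasserstein space. -/
def IsGeodesicOn {d : ℕ} (ω : ℝ → P2 d) (t₀ t₁ : ℝ) : Prop :=
  ∀ s₀ ∈ Icc t₀ t₁, ∀ s₁ ∈ Icc t₀ t₁,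
    W2 (ω s₀).1 (ω s₁).1 = |s₁ - s₀| / |t₁ - t₀| * W2 (ω t₀).1 (ω t₁).1

/-- `ω` is a piecewise geodesic interpolation of `ρ 0, …, ρ N`: on each `[n τ, (n + 1) τ]` with
`n < N` it is a geodesic from `ρ n` to `ρ (n + 1)`. -/
def IsGeodesicInterpolation {d : ℕ} (τ : ℝ) (N : ℕ) (ρ : ℕ → P2 d) (ω : ℝ → P2 d) : Prop :=
  ∀ n : ℕ, n < N → ω (n * τ) = ρ n ∧ ω ((n + 1) * τ) = ρ (n + 1) ∧
    IsGeodesicOn ω (n * τ) ((n + 1) * τ)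

/-- Absolute continuity on `[0, T]` with respect to `W₂`: there is `m ∈ L¹(0, T)` with
`W₂(ω(s), ω(t)) ≤ ∫ₛᵗ m` whenever `0 ≤ s ≤ t ≤ T`. -/
def IsAbsolutelyContinuousCurve {d : ℕ} {Ω : Set (Space d)} (T : ℝ) (ω : ℝ → POn Ω) : Prop :=
  ∃ m : ℝ → ℝ, IntervalIntegrable m volume 0 T ∧
    ∀ s t : ℝ, 0 ≤ s → s ≤ t → t ≤ T → W2 (ω s).1 (ω t).1 ≤ ∫ r in s..t, m r

end EVBDF2

end

/-! Everything rests on a bound `∑ W2 (ρ i) (ρ (i+1)) ^ 2 ≤ A * τ`, with `A` independent of `T`, `N`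
and the extrapolation; `K` is `√A`. Testing the minimality of `ρ (n+2)` with `ρ (n+1)`, and using
dissipativity and the triangle inequality through the extrapolated measure, bounds each squared jump
by `4θ²` times the preceding one plus a multiple of `τ` times the energy drop
(`IsSchemeSolution.step`). As `4θ² < 1`, this sums (`IsSchemeSolution.sum_sq_le`), the energy being
bounded below on the compact `P(Ω)`.

By Cauchy–Schwarz, the total jump over disjoint intervals is at most the root of `A` times their
total length, up to an error vanishing with `τ` (`sum_dist_piecewiseConst_le`). One interval gives
equicontinuity and, in the limit, the Hölder bound; families of intervals give absolute continuity.
Compactness for `W2` holds because weak convergence on a compact set implies `W2` convergence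
(`eventually_W2_lt`), so an Arzelà–Ascoli argument applies. It is run on the curve paired with its
arc length, whose limit is a real absolutely continuous function with the required density as
derivative. The geodesic estimate only needs that each single jump is at most `√(A * τ)`. -/

open ProbabilityTheory in
/-- Gluing of two measures along a common marginal. -/
theorem MeasureTheory.Measure.exists_gluing {X Y Z : Type*} [MeasurableSpace X]
    [MeasurableSpace Y] [MeasurableSpace Z] [StandardBorelSpace X] [StandardBorelSpace Z]
    [Nonempty X] [Nonempty Z] (γ₁ : Measure (X × Y)) (γ₂ : Measure (Y × Z))
    [IsFiniteMeasure γ₁] [IsFiniteMeasure γ₂] (h : γ₁.map Prod.snd = γ₂.map Prod.fst) :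
    ∃ π : Measure (Y × X × Z), π.map (fun p => (p.2.1, p.1)) = γ₁ ∧
      π.map (fun p => (p.1, p.2.2)) = γ₂ := by
  have hfst : (γ₁.map Prod.swap).fst = γ₂.fst := by
    rw [Measure.fst_map_swap]; exact h
  have h₁ : γ₂.fst ⊗ₘ (γ₁.map Prod.swap).condKernel = γ₁.map Prod.swap := by
    rw [← hfst]; exact Measure.disintegrate _ _
  have h₂ : γ₂.fst ⊗ₘ γ₂.condKernel = γ₂ := Measure.disintegrate _ _
  -- Disintegrate both measures over the common marginal and make the outer coordinates
  -- conditionally independent.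
  refine ⟨γ₂.fst ⊗ₘ ((γ₁.map Prod.swap).condKernel ×ₖ γ₂.condKernel), ?_, ?_⟩
  · have e : (fun p : Y × X × Z => (p.2.1, p.1)) = Prod.swap ∘ Prod.map id Prod.fst := rfl
    rw [e, ← Measure.map_map measurable_swap (by fun_prop), ← Measure.compProd_map measurable_fst,
      ← Kernel.fst_eq, Kernel.fst_prod, h₁, Measure.map_map measurable_swap measurable_swap]
    simp
  · have e : (fun p : Y × X × Z => (p.1, p.2.2)) = Prod.map id Prod.snd := rfl
    rw [e, ← Measure.compProd_map measurable_snd, ← Kernel.snd_eq, Kernel.snd_prod, h₂]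

/-! ### The Wasserstein pseudometric -/

namespace EVBDF2

variable {d : ℕ}

theorem W2_nonneg (μ ν : ProbabilityMeasure (Space d)) : 0 ≤ W2 μ ν := Real.sqrt_nonneg _

theorem W2_le_of_coupling {μ ν : ProbabilityMeasure (Space d)} {γ : Measure (Space d × Space d)}
    (hγ : γ ∈ couplings μ ν) {r : ℝ} (hr : 0 ≤ r)
    (h : ∫⁻ p, ‖p.1 - p.2‖ₑ ^ 2 ∂γ ≤ ENNReal.ofReal (r ^ 2)) : W2 μ ν ≤ r := by
  have h1 : W2sq μ ν ≤ ENNReal.ofReal (r ^ 2) := (iInf₂_le γ hγ).trans h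
  exact Real.sqrt_le_iff.2 ⟨hr, ENNReal.toReal_le_of_le_ofReal (by positivity) h1⟩

/-- Near-optimal couplings suffice, so no optimal plan is ever needed. Finite second moments matter
here: `toReal` would turn an infinite cost into distance zero. -/
theorem exists_coupling_of_W2_lt {μ ν : P2 d} {r : ℝ} (h : W2 μ.1 ν.1 < r) :
    ∃ γ ∈ couplings μ.1 ν.1, ∫⁻ p, ‖p.1 - p.2‖ₑ ^ 2 ∂γ < ENNReal.ofReal (r ^ 2) := by
  have hr : 0 < r := (W2_nonneg _ _).trans_lt h
  have h1 : W2sq μ.1 ν.1 < ENNReal.ofReal (r ^ 2) := by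
    rw [← ENNReal.ofReal_toReal (W2sq_lt_top μ ν).ne, ENNReal.ofReal_lt_ofReal_iff (by positivity)]
    exact (Real.sqrt_lt' hr).1 h
  simpa [W2sq, iInf_lt_iff] using h1

theorem isProbabilityMeasure_of_mem_couplings {μ ν : ProbabilityMeasure (Space d)}
    {γ : Measure (Space d × Space d)} (hγ : γ ∈ couplings μ ν) : IsProbabilityMeasure γ := by
  constructor
  have h : γ.map Prod.fst univ = 1 := by rw [hγ.1]; simp
  rwa [Measure.map_apply measurable_fst MeasurableSet.univ] at h

theorem W2_self (μ : ProbabilityMeasure (Space d)) : W2 μ μ = 0 := by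
  refine le_antisymm (W2_le_of_coupling (γ := (μ : Measure (Space d)).map (fun x => (x, x)))
    ⟨?_, ?_⟩ le_rfl ?_) (W2_nonneg _ _)
  · rw [Measure.map_map measurable_fst (by fun_prop)]
    exact Measure.map_id
  · rw [Measure.map_map measurable_snd (by fun_prop)]
    exact Measure.map_id
  · rw [lintegral_map (by fun_prop) (by fun_prop)]
    simp

theorem W2sq_le_swap (μ ν : ProbabilityMeasure (Space d)) : W2sq μ ν ≤ W2sq ν μ := by
  refine le_iInf₂ fun γ hγ => (iInf₂_le (γ.map Prod.swap) ?_).trans (le_of_eq ?_)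
  · constructor
    · rw [Measure.map_map measurable_fst measurable_swap]
      exact hγ.2
    · rw [Measure.map_map measurable_snd measurable_swap]
      exact hγ.1
  · rw [lintegral_map (by fun_prop) measurable_swap]
    refine lintegral_congr fun p => ?_
    rw [Prod.fst_swap, Prod.snd_swap, ← enorm_neg, neg_sub]

theorem W2_comm (μ ν : ProbabilityMeasure (Space d)) : W2 μ ν = W2 ν μ := by
  rw [W2, W2, le_antisymm (W2sq_le_swap μ ν) (W2sq_le_swap ν μ)]

/-- Minkowski's inequality in `L²(π)`, with the square roots cleared. -/
theorem lintegral_enorm_sq_add_le {α : Type*} [MeasurableSpace α] (π : Measure α)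
    {f g : α → Space d} (hf : Measurable f) (hg : Measurable g) {r s : ℝ} (hr : 0 ≤ r)
    (hs : 0 ≤ s) (hfr : ∫⁻ x, ‖f x‖ₑ ^ 2 ∂π ≤ ENNReal.ofReal (r ^ 2))
    (hgs : ∫⁻ x, ‖g x‖ₑ ^ 2 ∂π ≤ ENNReal.ofReal (s ^ 2)) :
    ∫⁻ x, ‖f x + g x‖ₑ ^ 2 ∂π ≤ ENNReal.ofReal ((r + s) ^ 2) := by
  have key : ∀ h : α → Space d, eLpNorm h 2 π ^ 2 = ∫⁻ x, ‖h x‖ₑ ^ 2 ∂π := fun h => by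
    have := eLpNorm_nnreal_pow_eq_lintegral (f := h) (p := 2) (μ := π) (by norm_num)
    simpa using this
  have le_of : ∀ (h : α → Space d) {t : ℝ}, 0 ≤ t →
      ∫⁻ x, ‖h x‖ₑ ^ 2 ∂π ≤ ENNReal.ofReal (t ^ 2) → eLpNorm h 2 π ≤ ENNReal.ofReal t := by
    intro h t ht hle
    rw [← key, ENNReal.ofReal_pow ht] at hle
    exact (ENNReal.pow_le_pow_left_iff two_ne_zero).1 hle
  have e := key (f + g)
  simp only [Pi.add_apply] at e
  rw [← e, ENNReal.ofReal_pow (by positivity), ENNReal.ofReal_add hr hs]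
  gcongr
  exact (eLpNorm_add_le hf.aestronglyMeasurable hg.aestronglyMeasurable (by norm_num)).trans
    (add_le_add (le_of f hr hfr) (le_of g hs hgs))

/-- Glue two near-optimal couplings along `ν`, project to the outer coordinates and apply Minkowski.
-/
theorem W2_triangle (μ ν σ : P2 d) : W2 μ.1 σ.1 ≤ W2 μ.1 ν.1 + W2 ν.1 σ.1 := by
  refine le_of_forall_pos_le_add fun ε hε => ?_
  obtain ⟨γ₁, h₁, hc₁⟩ := exists_coupling_of_W2_lt
    (show W2 μ.1 ν.1 < W2 μ.1 ν.1 + ε / 2 by linarith)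
  obtain ⟨γ₂, h₂, hc₂⟩ := exists_coupling_of_W2_lt
    (show W2 ν.1 σ.1 < W2 ν.1 σ.1 + ε / 2 by linarith)
  have := isProbabilityMeasure_of_mem_couplings h₁
  have := isProbabilityMeasure_of_mem_couplings h₂
  obtain ⟨π, rfl, rfl⟩ := Measure.exists_gluing γ₁ γ₂ (h₁.2.trans h₂.1.symm)
  have n₁ := W2_nonneg μ.1 ν.1
  have n₂ := W2_nonneg ν.1 σ.1
  rw [lintegral_map (by fun_prop) (by fun_prop)] at hc₁ hc₂
  have hfst := h₁.1
  have hsnd := h₂.2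
  rw [Measure.map_map (by fun_prop) (by fun_prop)] at hfst hsnd
  refine (W2_le_of_coupling (γ := π.map Prod.snd) (r := W2 μ.1 ν.1 + ε / 2 + (W2 ν.1 σ.1 + ε / 2))
    ⟨?_, ?_⟩ (by positivity) ?_).trans (by linarith)
  · rw [Measure.map_map (by fun_prop) (by fun_prop)]
    exact hfst
  · rw [Measure.map_map (by fun_prop) (by fun_prop)]
    exact hsnd
  · rw [lintegral_map (by fun_prop) (by fun_prop)]
    simpa using lintegral_enorm_sq_add_le π (f := fun p => p.2.1 - p.1) (g := fun p => p.1 - p.2.2)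
      (by fun_prop) (by fun_prop) (by positivity) (by positivity) hc₁.le hc₂.le

end EVBDF2

/-! ### Weak convergence and compactness in the Wasserstein distance -/

/-- A compact set is covered by finitely many disjoint measurable sets of small diameter, the
boundaries of which are null sets. -/
theorem IsCompact.exists_finite_partition_null_frontier {X : Type*} [PseudoMetricSpace X]
    [MeasurableSpace X] [OpensMeasurableSpace X] {K : Set X} (hK : IsCompact K) (μ : Measure X)
    [SFinite μ] {ε : ℝ} (hε : 0 < ε) :
    ∃ (N : ℕ) (A : ℕ → Set X), (∀ i, MeasurableSet (A i)) ∧ (∀ i, μ (frontier (A i)) = 0) ∧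
      (∀ i, ∀ x ∈ A i, ∀ y ∈ A i, dist x y ≤ ε) ∧ Pairwise (Function.onFun Disjoint A) ∧
      K ⊆ ⋃ i ∈ Finset.range N, A i := by
  have hr : ∀ x : X, ∃ r ∈ Ioo 0 (ε / 2), μ (frontier (Metric.ball x r)) = 0 := fun x => by
    simpa [Metric.thickening_singleton] using
      exists_null_frontier_thickening μ {x} (show (0 : ℝ) < ε / 2 by positivity)
  choose r hr hr0 using hr
  obtain ⟨F, hF⟩ := hK.elim_finite_subcover (fun x => Metric.ball x (r x))
    (fun _ => Metric.isOpen_ball) fun x _ => mem_iUnion.2 ⟨x, Metric.mem_ball_self (hr x).1⟩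
  let B : ℕ → Set X := fun n =>
    if h : n < F.toList.length then Metric.ball F.toList[n] (r F.toList[n]) else ∅
  have hB : ∀ n, B n = ∅ ∨ ∃ x, B n = Metric.ball x (r x) := fun n => by
    by_cases h : n < F.toList.length
    · exact .inr ⟨F.toList[n], by simp only [B, dif_pos h]⟩
    · exact .inl (by simp only [B, dif_neg h])
  have hBm : ∀ n, MeasurableSet (B n) := fun n => by
    rcases hB n with h | ⟨x, h⟩ <;> rw [h]
    · exact MeasurableSet.empty
    · exact measurableSet_ball
  have hB0 : ∀ n, μ (frontier (B n)) = 0 := fun n => by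
    rcases hB n with h | ⟨x, h⟩ <;> rw [h]
    · simp
    · exact hr0 x
  refine ⟨F.toList.length, disjointed B, fun i => MeasurableSet.disjointed hBm i, fun i => ?_,
    fun i x hx y hy => ?_, disjoint_disjointed B, fun x hx => ?_⟩
  -- Null frontiers survive complements and finite intersections, hence the passage to differences.
  · refine disjointedRec (p := fun A => μ (frontier A) = 0) (fun t j ht => ?_) (hB0 i)
    rw [sdiff_eq]
    exact null_frontier_inter ht (by rw [frontier_compl]; exact hB0 j)
  · have hx := disjointed_subset B i hx
    have hy := disjointed_subset B i hy
    rcases hB i with h | ⟨z, h⟩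
    · simp [h] at hx
    · rw [h] at hx hy
      have h1 := dist_triangle_right x y z
      have h2 := (hr z).2
      rw [Metric.mem_ball] at hx hy
      linarith
  · obtain ⟨z, hz, hxz⟩ := mem_iUnion₂.1 (hF hx)
    obtain ⟨n, hn, rfl⟩ := List.getElem_of_mem (Finset.mem_toList.2 hz)
    have hxB : x ∈ ⋃ i ∈ Finset.range F.toList.length, B i :=
      mem_iUnion₂.2 ⟨n, Finset.mem_range.2 hn, by simpa only [B, dif_pos hn] using hxz⟩
    obtain ⟨m, hm, hxm⟩ := mem_iUnion₂.1 hxB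
    have hxd : x ∈ ⋃ i, disjointed B i := by
      rw [iUnion_disjointed]; exact mem_iUnion.2 ⟨m, hxm⟩
    obtain ⟨l, hl⟩ := mem_iUnion.1 hxd
    refine mem_iUnion₂.2 ⟨l, Finset.mem_range.2 ?_, hl⟩
    by_contra hcon
    have := disjointed_subset B l hl
    simp only [B, dif_neg hcon] at this
    exact this

namespace EVBDF2

variable {d : ℕ}

open ProbabilityTheory in
/-- If `ν` gives almost as much mass as `μ` to each set of a fine partition, then the two measures
are close in Wasserstein distance. -/
theorem W2_le_of_partition {Ω : Set (Space d)} (μ ν : POn Ω) {N : ℕ} {A : ℕ → Set (Space d)}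
    (hAm : ∀ i, MeasurableSet (A i)) (hAd : Pairwise (Function.onFun Disjoint A))
    (hΩA : Ω ⊆ ⋃ i ∈ Finset.range N, A i) {ε D t : ℝ}
    (hε : ∀ i, ∀ x ∈ A i, ∀ y ∈ A i, dist x y ≤ ε)
    (hD : ∀ x ∈ Ω, ∀ y ∈ Ω, dist x y ≤ D) (ht : t ∈ Icc (0 : ℝ) 1)
    (hle : ∀ i, ENNReal.ofReal (1 - t) * (μ.1 : Measure (Space d)) (A i)
      ≤ (ν.1 : Measure (Space d)) (A i)) :
    W2 μ.1 ν.1 ≤ √(ε ^ 2 + t * D ^ 2) := by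
  set m : Measure (Space d) := (μ.1 : Measure (Space d))
  set n : Measure (Space d) := (ν.1 : Measure (Space d))
  set s := ENNReal.ofReal (1 - t)
  have hst : s + ENNReal.ofReal t = 1 := by
    rw [← ENNReal.ofReal_add (by linarith [ht.2]) ht.1]; simp
  have hs1 : s ≤ 1 := hst ▸ le_self_add
  have hsum : ∀ κ : POn Ω, ∑ i ∈ Finset.range N, (κ.1 : Measure (Space d)).restrict (A i)
      = (κ.1 : Measure (Space d)) := by
    intro κ
    have h1 : (κ.1 : Measure (Space d)).restrict (⋃ i ∈ Finset.range N, A i)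
        = (κ.1 : Measure (Space d)) := Measure.restrict_eq_self_of_ae_mem
      ((show ∀ᵐ x ∂(κ.1 : Measure (Space d)), x ∈ Ω from κ.2).mono hΩA)
    conv_rhs => rw [← h1]
    rw [Measure.restrict_biUnion_finset (fun i _ j _ hij => hAd hij) hAm,
      Measure.sum_fintype, Finset.sum_coe_sort _ (fun i => (κ.1 : Measure (Space d)).restrict (A i))]
  have hmass : ∀ κ : POn Ω, ∑ i ∈ Finset.range N, (κ.1 : Measure (Space d)) (A i) = 1 := by
    intro κ
    have := congrArg (fun ρ : Measure (Space d) => ρ univ) (hsum κ)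
    simpa using this
  have hcond : ∀ κ : POn Ω, ∀ i, (κ.1 : Measure (Space d)) (A i) •
      ((κ.1 : Measure (Space d))[|A i]) = (κ.1 : Measure (Space d)).restrict (A i) := by
    intro κ i
    by_cases h : (κ.1 : Measure (Space d)) (A i) = 0
    · rw [h, zero_smul, Measure.restrict_eq_zero.2 h]
    · rw [ProbabilityTheory.cond, smul_smul, ENNReal.mul_inv_cancel h (measure_ne_top _ _),
        one_smul]
  have hcond1 : ∀ κ : POn Ω, ∀ i, (κ.1 : Measure (Space d)) (A i) ≠ 0 →
      ((κ.1 : Measure (Space d))[|A i]) univ = 1 := fun κ i h =>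
    (cond_isProbabilityMeasure h).measure_univ
  -- The surplus of `ν` over `s * μ` on each cell; `hle` makes the truncated subtraction exact.
  let r : ℕ → ℝ≥0∞ := fun i => n (A i) - s * m (A i)
  have hr : ∀ i, s * m (A i) + r i = n (A i) := fun i => add_tsub_cancel_of_le (hle i)
  have hrsum : ∑ i ∈ Finset.range N, r i = ENNReal.ofReal t := by
    have h1 : s + ∑ i ∈ Finset.range N, r i = s + ENNReal.ofReal t := by
      rw [hst, ← hmass ν, ← Finset.sum_congr rfl fun i _ => hr i, Finset.sum_add_distrib,
        ← Finset.mul_sum, hmass μ, mul_one]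
    exact (ENNReal.add_right_inj (hs1.trans_lt ENNReal.one_lt_top).ne).1 h1
  have hm0 : ∀ i, n (A i) = 0 → s * m (A i) = 0 := fun i h => le_antisymm (h ▸ hle i) (zero_le)
  have hr0 : ∀ i, n (A i) = 0 → r i = 0 := fun i h => by simp [r, h]
  have hκmass : (∑ i ∈ Finset.range N, r i • n[|A i]) univ = ENNReal.ofReal t := by
    rw [← hrsum, Measure.finsetSum_apply]
    refine Finset.sum_congr rfl fun i _ => ?_
    rw [Measure.smul_apply, smul_eq_mul]
    by_cases h : n (A i) = 0
    · rw [hr0 i h, zero_mul]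
    · rw [hcond1 ν i h, mul_one]
  have hfin : IsFiniteMeasure (∑ i ∈ Finset.range N, r i • n[|A i]) :=
    ⟨by rw [hκmass]; exact ENNReal.ofReal_lt_top⟩
  -- `γ₁` moves the fraction `s` of `μ` within cells, at distance at most `ε`. `γ₂` spreads the
  -- remaining fraction `t` over the surplus of `ν`, at distance at most `D`. On a null cell the
  -- conditional measure is zero, which forces the case splits below.
  let γ₁ : Measure (Space d × Space d) :=
    ∑ i ∈ Finset.range N, (s * m (A i)) • (m[|A i]).prod (n[|A i])
  let γ₂ : Measure (Space d × Space d) := m.prod (∑ i ∈ Finset.range N, r i • n[|A i])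
  have hγ : γ₁ + γ₂ ∈ couplings μ.1 ν.1 := by
    constructor
    · rw [Measure.map_add _ _ measurable_fst, Measure.map_fst_prod]
      simp only [γ₁, Measure.map_finset_sum measurable_fst.aemeasurable, Measure.map_smul,
        Measure.map_fst_prod]
      have e1 : ∑ i ∈ Finset.range N, (s * m (A i)) • (n[|A i]) univ • (m[|A i]) = s • m := by
        conv_rhs => rw [← show _ = m from hsum μ, Finset.smul_sum]
        refine Finset.sum_congr rfl fun i _ => ?_
        rw [← show _ = m.restrict (A i) from hcond μ i, smul_smul, smul_smul]
        by_cases h : n (A i) = 0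
        · rw [hm0 i h, zero_mul]
        · rw [hcond1 ν i h, mul_one]
      rw [e1, hκmass, ← add_smul, hst, one_smul]
    · rw [Measure.map_add _ _ measurable_snd, Measure.map_snd_prod]
      simp only [γ₁, Measure.map_finset_sum measurable_snd.aemeasurable, Measure.map_smul,
        Measure.map_snd_prod]
      rw [show m univ = 1 from measure_univ, one_smul, ← Finset.sum_add_distrib]
      conv_rhs => rw [show ((ν.1 : ProbabilityMeasure (Space d)) : Measure (Space d)) = n from rfl,
        ← show _ = n from hsum ν]
      refine Finset.sum_congr rfl fun i _ => ?_
      rw [← hcond ν i]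
      change _ = n (A i) • n[|A i]
      rw [← hr i, add_smul, smul_smul]
      by_cases h : m (A i) = 0
      · rw [h, mul_zero, zero_mul]
      · rw [hcond1 μ i h, mul_one]
  have hcost : ∀ {x y : Space d} {e : ℝ}, dist x y ≤ e → ‖x - y‖ₑ ^ 2 ≤ ENNReal.ofReal (e ^ 2) := by
    intro x y e h
    rw [ENNReal.ofReal_pow (dist_nonneg.trans h), ← ofReal_norm, ← dist_eq_norm]
    gcongr
  have hint : ∀ (γ : Measure (Space d × Space d)) (e : ℝ), (∀ᵐ p ∂γ, dist p.1 p.2 ≤ e) →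
      ∫⁻ p, ‖p.1 - p.2‖ₑ ^ 2 ∂γ ≤ ENNReal.ofReal (e ^ 2) * γ univ := by
    intro γ e h
    rw [← lintegral_const]
    exact lintegral_mono_ae (h.mono fun p hp => hcost hp)
  have hc₁ : ∫⁻ p, ‖p.1 - p.2‖ₑ ^ 2 ∂γ₁ ≤ ENNReal.ofReal (ε ^ 2) := by
    rw [lintegral_finsetSum_measure]
    calc _ ≤ ∑ i ∈ Finset.range N, m (A i) * ENNReal.ofReal (ε ^ 2) := by
          refine Finset.sum_le_sum fun i _ => ?_
          rw [lintegral_smul_measure, smul_eq_mul]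
          have hle1 : s * m (A i) ≤ m (A i) := mul_le_of_le_one_left' hs1
          refine mul_le_mul' hle1 ?_
          refine (hint _ ε ?_).trans ?_
          · have h1 : ∀ᵐ p ∂(m[|A i]).prod (n[|A i]), p.1 ∈ A i :=
              Measure.quasiMeasurePreserving_fst.ae (ae_cond_mem (hAm i))
            have h2 : ∀ᵐ p ∂(m[|A i]).prod (n[|A i]), p.2 ∈ A i :=
              Measure.quasiMeasurePreserving_snd.ae (ae_cond_mem (hAm i))
            filter_upwards [h1, h2] with p hp1 hp2
            exact hε i _ hp1 _ hp2
          · refine mul_le_of_le_one_right' ?_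
            rw [← univ_prod_univ, Measure.prod_prod]
            exact mul_le_one' prob_le_one prob_le_one
      _ = _ := by rw [← Finset.sum_mul, hmass μ, one_mul]
  have hc₂ : ∫⁻ p, ‖p.1 - p.2‖ₑ ^ 2 ∂γ₂ ≤ ENNReal.ofReal (t * D ^ 2) := by
    have hκ : ∑ i ∈ Finset.range N, r i • n[|A i] ≪ n := by
      refine Measure.AbsolutelyContinuous.mk fun B _ hB => ?_
      rw [Measure.finsetSum_apply]
      refine Finset.sum_eq_zero fun i _ => ?_
      rw [Measure.smul_apply, cond_absolutelyContinuous hB, smul_zero]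
    have h1 : ∀ᵐ p ∂γ₂, p.1 ∈ Ω :=
      Measure.quasiMeasurePreserving_fst.ae (show ∀ᵐ x ∂m, x ∈ Ω from μ.2)
    have h2 : ∀ᵐ p ∂γ₂, p.2 ∈ Ω :=
      Measure.quasiMeasurePreserving_snd.ae (hκ.ae_le (show ∀ᵐ x ∂n, x ∈ Ω from ν.2))
    refine (hint γ₂ D ?_).trans (le_of_eq ?_)
    · filter_upwards [h1, h2] with p hp1 hp2
      exact hD _ hp1 _ hp2
    · rw [← univ_prod_univ, Measure.prod_prod, hκmass, show m univ = 1 from measure_univ, one_mul,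
        mul_comm, ENNReal.ofReal_mul ht.1]
  refine W2_le_of_coupling hγ (Real.sqrt_nonneg _) ?_
  rw [Real.sq_sqrt (add_nonneg (sq_nonneg _) (mul_nonneg ht.1 (sq_nonneg _))),
    lintegral_add_measure, ENNReal.ofReal_add (sq_nonneg _) (mul_nonneg ht.1 (sq_nonneg _))]
  exact add_le_add hc₁ hc₂

/-- On measures concentrated on a compact set, weak convergence implies convergence in
Wasserstein distance. -/
theorem eventually_W2_lt {Ω : Set (Space d)} (hΩ : IsCompact Ω) (μ : POn Ω) {ε : ℝ} (hε : 0 < ε) :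
    ∀ᶠ ν in 𝓝 μ, W2 μ.1 ν.1 < ε := by
  obtain ⟨N, A, hAm, hA0, hAε, hAd, hΩA⟩ :=
    hΩ.exists_finite_partition_null_frontier (μ.1 : Measure (Space d))
      (show (0 : ℝ) < ε / 2 by positivity)
  obtain ⟨D, hD⟩ := hΩ.isBounded.subset_closedBall 0
  have hD' : ∀ x ∈ Ω, ∀ y ∈ Ω, dist x y ≤ 2 * D := fun x hx y hy => by
    have h1 := dist_triangle_right x y 0
    have h2 := Metric.mem_closedBall.1 (hD hx)
    have h3 := Metric.mem_closedBall.1 (hD hy)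
    linarith
  -- Chosen so that `(ε / 2) ^ 2 + t * (2 * D) ^ 2 < ε ^ 2`; the `+ 1` covers `D = 0`.
  let t : ℝ := min 1 (ε ^ 2 / (2 * ((2 * D) ^ 2 + 1)))
  have ht0 : 0 < t := lt_min one_pos (by positivity)
  have ht : t * (2 * D) ^ 2 < 3 / 4 * ε ^ 2 := by
    have h1 : t * (2 * ((2 * D) ^ 2 + 1)) ≤ ε ^ 2 :=
      (le_div_iff₀ (by positivity)).1 (min_le_right _ _)
    nlinarith [sq_nonneg (2 * D), pow_pos hε 2]
  have hcont : ∀ i ∈ Finset.range N, ∀ᶠ ν : POn Ω in 𝓝 μ,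
      ENNReal.ofReal (1 - t) * (μ.1 : Measure (Space d)) (A i)
        ≤ (ν.1 : Measure (Space d)) (A i) := by
    intro i _
    -- Portmanteau: cells with null frontier have converging masses, and the factor `1 - t < 1`
    -- leaves room wherever the limit mass is positive.
    have hlim := ProbabilityMeasure.tendsto_measure_of_null_frontier_of_tendsto'
      (continuous_subtype_val.tendsto μ) (hA0 i)
    by_cases h0 : (μ.1 : Measure (Space d)) (A i) = 0
    · simp [h0]
    · refine (hlim.eventually (lt_mem_nhds (a := ENNReal.ofReal (1 - t) *
        (μ.1 : Measure (Space d)) (A i)) ?_)).mono fun ν hν => hν.le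
      calc _ < 1 * (μ.1 : Measure (Space d)) (A i) := by
            refine ENNReal.mul_lt_mul_left h0 (measure_ne_top _ _) ?_
            rw [← ENNReal.ofReal_one]
            exact (ENNReal.ofReal_lt_ofReal_iff one_pos).2 (by linarith)
        _ = _ := one_mul _
  filter_upwards [(Filter.eventually_all_finset _).2 hcont] with ν hν
  -- The mass comparison is known only for the first `N` cells, so the others are emptied.
  let A' : ℕ → Set (Space d) := fun i => if i < N then A i else ∅
  have hA'A : ∀ i, A' i = A i ∨ A' i = ∅ := fun i => by
    by_cases h : i < N <;> simp [A', h]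
  refine (W2_le_of_partition μ ν (N := N) (A := A') (ε := ε / 2) (D := 2 * D) (t := t)
    (fun i => ?_) (fun i j hij => ?_) (fun x hx => ?_) (fun i x hx y hy => ?_) hD'
    ⟨ht0.le, min_le_left _ _⟩ (fun i => ?_)).trans_lt ((Real.sqrt_lt' hε).2 (by nlinarith))
  · rcases hA'A i with h | h <;> rw [h]
    exacts [hAm i, MeasurableSet.empty]
  · have h := hAd hij
    simp only [Function.onFun] at h ⊢
    rcases hA'A i with hi | hi <;> rcases hA'A j with hj | hj <;> simp [hi, hj, h]
  · obtain ⟨i, hi, hxi⟩ := mem_iUnion₂.1 (hΩA hx)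
    exact mem_iUnion₂.2 ⟨i, hi, by simpa [A', Finset.mem_range.1 hi] using hxi⟩
  · rcases hA'A i with h | h <;> rw [h] at hx hy
    · exact hAε i x hx y hy
    · exact hx.elim
  · by_cases h : i < N
    · simpa [A', h] using hν i (Finset.mem_range.2 h)
    · simp [A', h]

/-- Prokhorov's theorem for the measures concentrated on a compact set. -/
theorem compactSpace_POn {Ω : Set (Space d)} (hΩ : IsCompact Ω) : CompactSpace (POn Ω) := by
  have h := isCompact_setOfPred_probabilityMeasure_mass_eq_compl_isCompact_le
    (E := Space d) (u := fun _ => 0) (K := fun _ => Ω) tendsto_const_nhds (fun _ => hΩ)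
    (.inl inferInstance)
  have h' : IsCompact {μ : ProbabilityMeasure (Space d) | (μ : Measure (Space d)) Ωᶜ = 0} := by
    convert h using 1
    ext μ
    simp [ProbabilityMeasure.null_iff_toMeasure_null]
  exact isCompact_iff_compactSpace.1 h'

/-- The set `P(Ω)`, to be endowed with the Wasserstein distance in place of the weak topology. -/
def WassersteinSpace (Ω : Set (Space d)) : Type := POn Ω

/-- The Wasserstein distance on the measures concentrated on a compact set. -/
noncomputable abbrev wassersteinPseudoMetricSpace {Ω : Set (Space d)} (hΩ : IsCompact Ω) :
    PseudoMetricSpace (WassersteinSpace Ω) where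
  dist μ ν := W2 μ.1 ν.1
  dist_self μ := W2_self μ.1
  dist_comm μ ν := W2_comm μ.1 ν.1
  dist_triangle μ ν σ :=
    W2_triangle (POn.toP2 hΩ μ) (POn.toP2 hΩ ν) (POn.toP2 hΩ σ)

/-- The identity from the weak topology is continuous, so compactness is inherited; the converse
comparison of topologies is not needed. -/
theorem compactSpace_wassersteinSpace {Ω : Set (Space d)} (hΩ : IsCompact Ω) :
    @CompactSpace (WassersteinSpace Ω)
      (wassersteinPseudoMetricSpace hΩ).toUniformSpace.toTopologicalSpace := by
  let _ := wassersteinPseudoMetricSpace hΩ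
  have := compactSpace_POn hΩ
  let f : POn Ω → WassersteinSpace Ω := fun μ => μ
  have hf : Continuous f := continuous_iff_continuousAt.2 fun μ =>
    Metric.tendsto_nhds.2 fun ε hε => (eventually_W2_lt hΩ μ hε).mono fun ν hν => by
      rw [dist_comm]
      exact hν
  refine ⟨?_⟩
  rw [← (range_eq_univ.2 fun μ => ⟨μ, rfl⟩ : range f = univ)]
  exact isCompact_range hf

end EVBDF2

/-! ### Arzelà–Ascoli up to a vanishing error -/

/-- A version of the Arzelà–Ascoli theorem for curves that are equicontinuous up to a vanishing
error. -/
theorem exists_subseq_tendstoUniformly_of_dist_le_sqrt {Z : Type*} [PseudoMetricSpace Z]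
    {K : Set Z} (hK : IsCompact K) {A T : ℝ} (hT : 0 ≤ T) {τ : ℕ → ℝ}
    (hτ : Tendsto τ atTop (𝓝 0)) {u : ℕ → ℝ → Z} (huK : ∀ k, ∀ t ∈ Icc 0 T, u k t ∈ K)
    (hu : ∀ k, ∀ s ∈ Icc 0 T, ∀ t ∈ Icc 0 T, dist (u k s) (u k t) ≤ √(A * (|t - s| + τ k))) :
    ∃ ψ : ℕ → ℕ, StrictMono ψ ∧ ∃ g : ℝ → Z,
      ∀ ε : ℝ, 0 < ε → ∀ᶠ k in atTop, ∀ t ∈ Icc 0 T, dist (u (ψ k) t) (g t) < ε := by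
  -- Clamping to `[0, T]` lets all rationals index the sample times, endpoints included.
  let c : ℝ → ℝ := fun t => max 0 (min t T)
  have hc : ∀ t, c t ∈ Icc 0 T := fun t => ⟨le_max_left _ _, max_le hT (min_le_right _ _)⟩
  have hct : ∀ t ∈ Icc 0 T, c t = t := fun t ht => by simp [c, ht.1, ht.2]
  -- Sequential compactness of a countable product replaces the diagonal extraction.
  have hseq : IsSeqCompact (Set.pi univ fun _ : ℚ => K) :=
    (isCompact_univ_pi fun _ => hK).isSeqCompact
  obtain ⟨v, -, ψ, hψ, hlim⟩ := hseq (x := fun k q => u k (c q)) fun k q _ => huK k _ (hc q)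
  rw [tendsto_pi_nhds] at hlim
  have hcauchy : ∀ ε : ℝ, 0 < ε → ∃ n : ℕ, ∀ k ≥ n, ∀ l ≥ n, ∀ t ∈ Icc 0 T,
      dist (u (ψ k) t) (u (ψ l) t) < ε := by
    intro ε hε
    have hmod : Tendsto (fun p : ℝ × ℝ => √(A * (p.1 + p.2))) (𝓝 (0, 0)) (𝓝 0) := by
      have : Continuous fun p : ℝ × ℝ => √(A * (p.1 + p.2)) := by fun_prop
      simpa using this.tendsto (0, 0)
    have hev := hmod.eventually (gt_mem_nhds (show (0 : ℝ) < ε / 4 by positivity))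
    rw [nhds_prod_eq] at hev
    obtain ⟨p, hp, q, hq, hpq⟩ := Filter.eventually_prod_iff.1 hev
    obtain ⟨δ, hδ, hpδ⟩ := Metric.eventually_nhds_iff.1 hp
    have hmodk : ∀ᶠ k in atTop, q (τ (ψ k)) := (hτ.comp hψ.tendsto_atTop).eventually hq
    have hcov : Icc (0 : ℝ) T ⊆ ⋃ r : ℚ, Metric.ball (r : ℝ) δ := by
      intro t _
      obtain ⟨r, hr1, hr2⟩ := exists_rat_btwn (show t - δ < t by linarith)
      refine mem_iUnion.2 ⟨r, ?_⟩
      rw [Metric.mem_ball, Real.dist_eq, abs_lt]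
      constructor <;> linarith
    obtain ⟨F, hF⟩ := isCompact_Icc.elim_finite_subcover _ (fun _ => Metric.isOpen_ball) hcov
    have hFk : ∀ᶠ k in atTop, ∀ r ∈ F, dist (u (ψ k) (c r)) (v r) < ε / 4 :=
      (Filter.eventually_all_finset F).2 fun r _ =>
        (Metric.tendsto_nhds.1 (hlim r)) (ε / 4) (by positivity)
    obtain ⟨n, hn⟩ := eventually_atTop.1 (hmodk.and hFk)
    refine ⟨n, fun k hk l hl t ht => ?_⟩
    obtain ⟨r, hrF, hr⟩ := mem_iUnion₂.1 (hF ht)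
    have hclose : dist |t - c r| 0 < δ := by
      rw [dist_zero_right, Real.norm_eq_abs, abs_abs]
      refine lt_of_le_of_lt ?_ hr
      obtain ⟨h0, h1⟩ := ht
      rw [Real.dist_eq]
      simp only [c]
      grind
    have h1 : ∀ k ≥ n, dist (u (ψ k) t) (u (ψ k) (c r)) < ε / 4 := fun k hk => by
      rw [dist_comm]
      exact (hu _ _ (hc r) _ ht).trans_lt (hpq (hpδ hclose) (hn k hk).1)
    calc dist (u (ψ k) t) (u (ψ l) t)
        ≤ dist (u (ψ k) t) (u (ψ k) (c r)) + dist (u (ψ k) (c r)) (v r)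
          + dist (v r) (u (ψ l) t) := dist_triangle4 _ _ _ _
      _ ≤ dist (u (ψ k) t) (u (ψ k) (c r)) + dist (u (ψ k) (c r)) (v r)
          + (dist (u (ψ l) (c r)) (v r) + dist (u (ψ l) t) (u (ψ l) (c r))) := by
          rw [add_comm (dist (u (ψ l) (c r)) (v r)), dist_comm (v r)]
          gcongr
          exact dist_triangle _ _ _
      _ < ε := by
          linarith [h1 k hk, h1 l hl, (hn k hk).2 r hrF, (hn l hl).2 r hrF]
  have hex : ∀ t, ∃ z, t ∈ Icc 0 T → Tendsto (fun k => u (ψ k) t) atTop (𝓝 z) := by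
    intro t
    by_cases ht : t ∈ Icc 0 T
    · have hC : CauchySeq fun k => u (ψ k) t := Metric.cauchySeq_iff.2 fun ε hε => by
        obtain ⟨n, hn⟩ := hcauchy ε hε
        exact ⟨n, fun k hk l hl => hn k hk l hl t ht⟩
      obtain ⟨z, -, hz⟩ := cauchySeq_tendsto_of_isComplete hK.isComplete
        (fun k => huK (ψ k) t ht) hC
      exact ⟨z, fun _ => hz⟩
    · exact ⟨u 0 t, fun h => absurd h ht⟩
  choose g hg using hex
  refine ⟨ψ, hψ, g, fun ε hε => ?_⟩
  obtain ⟨n, hn⟩ := hcauchy (ε / 2) (by positivity)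
  filter_upwards [eventually_ge_atTop n] with k hk t ht
  refine lt_of_le_of_lt (le_of_tendsto (tendsto_const_nhds.dist (hg t ht)) ?_) (half_lt_self hε)
  filter_upwards [eventually_ge_atTop n] with l hl
  exact (hn k hk l hl t ht).le

/-! ### Piecewise constant curves with square summable jumps -/

namespace EVBDF2

theorem natCeil_sub_one_le {x : ℝ} (hx : 0 ≤ x) : ((⌈x⌉₊ - 1 : ℕ) : ℝ) ≤ x := by
  rcases Nat.eq_zero_or_pos ⌈x⌉₊ with h | h
  · simpa [h] using hx
  · rw [Nat.cast_sub h]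
    have := Nat.ceil_lt_add_one hx
    push_cast
    linarith

theorem sub_one_le_natCeil_sub_one (x : ℝ) : x - 1 ≤ ((⌈x⌉₊ - 1 : ℕ) : ℝ) := by
  have h1 := Nat.le_ceil x
  have h2 : (⌈x⌉₊ : ℝ) ≤ ((⌈x⌉₊ - 1 : ℕ) : ℝ) + 1 := by
    exact_mod_cast (by omega : ⌈x⌉₊ ≤ ⌈x⌉₊ - 1 + 1)
  linarith

/-- The increments of a piecewise constant curve with square summable jumps over disjoint
intervals. -/
theorem sum_dist_piecewiseConst_le {d : ℕ → ℝ} {N : ℕ} {A T τ : ℝ}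
    (hτ : 0 < τ) (hN : N * τ = T) (hA : ∑ i ∈ Finset.range N, d i ^ 2 ≤ A * τ)
    (hd : ∀ i, 0 ≤ d i)
    {E : ℕ × (ℕ → ℝ × ℝ)} (hE : E ∈ AbsolutelyContinuousOnInterval.disjWithin 0 T) :
    ∑ i ∈ Finset.range E.1,
      dist (piecewiseConst τ (fun n => ∑ j ∈ Finset.range n, d j) (E.2 i).1)
        (piecewiseConst τ (fun n => ∑ j ∈ Finset.range n, d j) (E.2 i).2)
      ≤ √(A * ∑ i ∈ Finset.range E.1, (|(E.2 i).2 - (E.2 i).1| + τ)) := by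
  have hT : 0 ≤ T := by rw [← hN]; positivity
  obtain ⟨hmem, hdisj⟩ := hE
  rw [uIcc_of_le hT] at hmem
  let n : ℝ → ℕ := fun t => ⌈t / τ⌉₊ - 1
  have hnmono : Monotone n := fun s t h => by
    exact Nat.sub_le_sub_right (Nat.ceil_mono (by gcongr)) 1
  -- The jumps inside the `i`-th interval: the one of size `d j` occurs just after time `(j + 1) *
  -- τ`.
  let J : ℕ → Finset ℕ := fun i =>
    Finset.Ico (n (min (E.2 i).1 (E.2 i).2)) (n (max (E.2 i).1 (E.2 i).2))
  have hJmem : ∀ i j, j ∈ J i → min (E.2 i).1 (E.2 i).2 ≤ (j + 1) * τ ∧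
      (j + 1) * τ < max (E.2 i).1 (E.2 i).2 := by
    intro i j hj
    obtain ⟨h1, h2⟩ := Finset.mem_Ico.1 hj
    have h1' : ⌈min (E.2 i).1 (E.2 i).2 / τ⌉₊ ≤ j + 1 := by simp only [n] at h1; omega
    have h2' : j + 1 < ⌈max (E.2 i).1 (E.2 i).2 / τ⌉₊ := by simp only [n] at h2; omega
    rw [Nat.ceil_le, div_le_iff₀ hτ] at h1'
    rw [Nat.lt_ceil, lt_div_iff₀ hτ] at h2'
    exact ⟨by exact_mod_cast h1', by exact_mod_cast h2'⟩
  have hJdisj : Set.PairwiseDisjoint (Finset.range E.1 : Set ℕ) J := by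
    intro i hi k hk hik
    refine Finset.disjoint_left.2 fun j hji hjk => ?_
    have hd := hdisj hi hk hik
    obtain ⟨a1, a2⟩ := hJmem i j hji
    obtain ⟨b1, b2⟩ := hJmem k j hjk
    -- The jump time may be a left endpoint, outside `uIoc`; this slightly later time lies in both
    -- intervals.
    let x := min (max (E.2 i).1 (E.2 i).2) (max (E.2 k).1 (E.2 k).2)
    have hx : ((j : ℝ) + 1) * τ < x := lt_min a2 b2
    have hxi : x ∈ uIoc (E.2 i).1 (E.2 i).2 := ⟨a1.trans_lt hx, min_le_left _ _⟩
    have hxk : x ∈ uIoc (E.2 k).1 (E.2 k).2 := ⟨b1.trans_lt hx, min_le_right _ _⟩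
    exact Set.disjoint_left.1 hd hxi hxk
  have hJsub : (Finset.range E.1).biUnion J ⊆ Finset.range N := by
    intro j hj
    obtain ⟨i, hi, hji⟩ := Finset.mem_biUnion.1 hj
    have h1 := (hJmem i j hji).2.trans_le (max_le (hmem i hi).1.2 (hmem i hi).2.2)
    rw [← hN, mul_lt_mul_iff_left₀ hτ] at h1
    have h2 : j + 1 < N := by exact_mod_cast h1
    exact Finset.mem_range.2 (by omega)
  have hdist : ∀ i, dist (piecewiseConst τ (fun n => ∑ j ∈ Finset.range n, d j) (E.2 i).1)
        (piecewiseConst τ (fun n => ∑ j ∈ Finset.range n, d j) (E.2 i).2) = ∑ j ∈ J i, d j := by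
    intro i
    have key : ∀ a b : ℝ, a ≤ b → dist (piecewiseConst τ (fun n => ∑ j ∈ Finset.range n, d j) a)
        (piecewiseConst τ (fun n => ∑ j ∈ Finset.range n, d j) b)
          = ∑ j ∈ Finset.Ico (n a) (n b), d j := by
      intro a b hab
      rw [Finset.sum_Ico_eq_sub _ (hnmono hab), dist_comm, Real.dist_eq, abs_of_nonneg]
      · rfl
      · exact sub_nonneg.2 (Finset.sum_le_sum_of_subset_of_nonneg
          (Finset.range_mono (hnmono hab)) fun i _ _ => hd i)
    rcases le_total (E.2 i).1 (E.2 i).2 with h | h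
    · simpa [J, h] using key _ _ h
    · rw [dist_comm]
      simpa [J, h] using key _ _ h
  have hcard : ∀ i ∈ Finset.range E.1, ((J i).card : ℝ) * τ ≤ |(E.2 i).2 - (E.2 i).1| + τ := by
    intro i hi
    have hle : n (min (E.2 i).1 (E.2 i).2) ≤ n (max (E.2 i).1 (E.2 i).2) :=
      hnmono (min_le_left _ _ |>.trans (le_max_left _ _))
    have h1 := sub_one_le_natCeil_sub_one (min (E.2 i).1 (E.2 i).2 / τ)
    have h2 := natCeil_sub_one_le (x := max (E.2 i).1 (E.2 i).2 / τ)
      (div_nonneg ((hmem i hi).1.1.trans (le_max_left _ _)) hτ.le)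
    rw [Nat.card_Ico, Nat.cast_sub hle, ← max_sub_min_eq_abs]
    calc (((n (max (E.2 i).1 (E.2 i).2) : ℕ) : ℝ) - (n (min (E.2 i).1 (E.2 i).2) : ℕ)) * τ
        ≤ (max (E.2 i).1 (E.2 i).2 / τ - (min (E.2 i).1 (E.2 i).2 / τ - 1)) * τ := by
          gcongr
      _ = _ := by field_simp; ring
  calc _ = ∑ j ∈ (Finset.range E.1).biUnion J, d j := by
        rw [Finset.sum_biUnion hJdisj]
        exact Finset.sum_congr rfl fun i _ => hdist i
    _ ≤ _ := by
        apply Real.le_sqrt_of_sq_le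
        have hc : (((Finset.range E.1).biUnion J).card : ℝ) * τ
            ≤ ∑ i ∈ Finset.range E.1, (|(E.2 i).2 - (E.2 i).1| + τ) := by
          rw [Finset.card_biUnion hJdisj, Nat.cast_sum, Finset.sum_mul]
          exact Finset.sum_le_sum hcard
        have hs : ∑ j ∈ (Finset.range E.1).biUnion J, d j ^ 2 ≤ A * τ :=
          (Finset.sum_le_sum_of_subset_of_nonneg hJsub fun i _ _ => sq_nonneg _).trans hA
        have hA0 : 0 ≤ A := by
          have : 0 ≤ A * τ := (Finset.sum_nonneg fun i _ => sq_nonneg _).trans hA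
          exact nonneg_of_mul_nonneg_left this hτ
        -- Cauchy–Schwarz; the number of jumps times `τ` is the total length plus at most one `τ`
        -- per interval.
        calc _ ≤ (((Finset.range E.1).biUnion J).card : ℝ)
              * ∑ j ∈ (Finset.range E.1).biUnion J, d j ^ 2 := sq_sum_le_card_mul_sum_sq
          _ ≤ (((Finset.range E.1).biUnion J).card : ℝ) * (A * τ) := by gcongr
          _ = A * ((((Finset.range E.1).biUnion J).card : ℝ) * τ) := by ring
          _ ≤ _ := by gcongr

theorem dist_piecewiseConst_le {d : ℕ → ℝ} {N : ℕ} {A T τ : ℝ}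
    (hτ : 0 < τ) (hN : N * τ = T) (hA : ∑ i ∈ Finset.range N, d i ^ 2 ≤ A * τ)
    (hd : ∀ i, 0 ≤ d i) {s t : ℝ} (hs : s ∈ Icc 0 T) (ht : t ∈ Icc 0 T) :
    dist (piecewiseConst τ (fun n => ∑ j ∈ Finset.range n, d j) s)
        (piecewiseConst τ (fun n => ∑ j ∈ Finset.range n, d j) t)
      ≤ √(A * (|t - s| + τ)) := by
  have hT : 0 ≤ T := hs.1.trans hs.2
  have := sum_dist_piecewiseConst_le hτ hN hA hd (E := (1, fun _ => (s, t)))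
    ⟨by simp [uIcc_of_le hT, hs.1, hs.2, ht.1, ht.2], by simp⟩
  simpa using this

/-- Passing to the discrete arc length reduces estimates in `Y` to a monotone real function. -/
theorem dist_piecewiseConst_le_dist_sum {Y : Type*} [PseudoMetricSpace Y] (τ : ℝ) (y : ℕ → Y)
    (hτ : 0 < τ) (s t : ℝ) :
    dist (piecewiseConst τ y s) (piecewiseConst τ y t) ≤
      dist (piecewiseConst τ (fun n => ∑ j ∈ Finset.range n, dist (y j) (y (j + 1))) s)
        (piecewiseConst τ (fun n => ∑ j ∈ Finset.range n, dist (y j) (y (j + 1))) t) := by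
  wlog h : s ≤ t generalizing s t
  · rw [dist_comm, dist_comm (piecewiseConst τ (fun _ => _) s)]
    exact this t s (le_of_not_ge h)
  have hn : ⌈s / τ⌉₊ - 1 ≤ ⌈t / τ⌉₊ - 1 :=
    Nat.sub_le_sub_right (Nat.ceil_mono (by gcongr)) 1
  refine (dist_le_Ico_sum_dist y hn).trans ?_
  rw [Finset.sum_Ico_eq_sub _ hn, dist_comm, Real.dist_eq]
  exact le_abs_self _

/-- Compactness of piecewise constant curves in a compact space with a uniform bound on the sum of
the squared jumps. -/
theorem exists_subseq_piecewiseConst {Y : Type*} [PseudoMetricSpace Y] [CompactSpace Y]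
    {A T : ℝ} (hT : 0 < T) (N : ℕ → ℕ) (hN : ∀ k, 0 < N k)
    (hNlim : Tendsto N atTop atTop) (y : ℕ → ℕ → Y)
    (hy : ∀ k, ∑ i ∈ Finset.range (N k), dist (y k i) (y k (i + 1)) ^ 2 ≤ A * (T / N k)) :
    ∃ ψ : ℕ → ℕ, StrictMono ψ ∧ ∃ g : ℝ → Y,
      (∀ ε : ℝ, 0 < ε → ∀ᶠ k in atTop, ∀ t ∈ Icc 0 T,
        dist (piecewiseConst (T / N (ψ k)) (y (ψ k)) t) (g t) < ε) ∧
      (∃ m : ℝ → ℝ, IntervalIntegrable m volume 0 T ∧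
        ∀ s t : ℝ, 0 ≤ s → s ≤ t → t ≤ T → dist (g s) (g t) ≤ ∫ r in s..t, m r) ∧
      (∀ s ∈ Icc 0 T, ∀ t ∈ Icc 0 T, dist (g s) (g t) ≤ √A * √|t - s|) := by
  let τ : ℕ → ℝ := fun k => T / N k
  have hτpos : ∀ k, 0 < τ k := fun k => div_pos hT (Nat.cast_pos.2 (hN k))
  have hNτ : ∀ k, N k * τ k = T := fun k =>
    mul_div_cancel₀ T (Nat.cast_ne_zero.2 (hN k).ne')
  have hτlim : Tendsto τ atTop (𝓝 0) :=
    tendsto_const_nhds.div_atTop (tendsto_natCast_atTop_atTop.comp hNlim)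
  have hτT : ∀ k, τ k ≤ T := fun k => div_le_self hT.le (Nat.one_le_cast.2 (hN k))
  have hA0 : 0 ≤ A := by
    have : 0 ≤ A * τ 0 := (Finset.sum_nonneg fun i _ => sq_nonneg _).trans (hy 0)
    exact nonneg_of_mul_nonneg_left this (hτpos 0)
  let S : ℕ → ℝ → ℝ := fun k =>
    piecewiseConst (τ k) (fun n => ∑ j ∈ Finset.range n, dist (y k j) (y k (j + 1)))
  -- Pairing makes one extraction serve both the curve and its arc length.
  let u : ℕ → ℝ → Y × ℝ := fun k t => (piecewiseConst (τ k) (y k) t, S k t)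
  have hS : ∀ k, ∀ s ∈ Icc 0 T, ∀ t ∈ Icc 0 T, dist (S k s) (S k t) ≤ √(A * (|t - s| + τ k)) :=
    fun k s hs t ht => dist_piecewiseConst_le (hτpos k) (hNτ k) (hy k) (fun _ => dist_nonneg) hs ht
  have hyS : ∀ k s t, dist (piecewiseConst (τ k) (y k) s) (piecewiseConst (τ k) (y k) t)
      ≤ dist (S k s) (S k t) := fun k s t =>
    dist_piecewiseConst_le_dist_sum (τ k) (y k) (hτpos k) s t
  have h0 : (0 : ℝ) ∈ Icc 0 T := ⟨le_rfl, hT.le⟩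
  obtain ⟨ψ, hψ, g, hg⟩ := exists_subseq_tendstoUniformly_of_dist_le_sqrt (A := A)
    (K := univ ×ˢ Metric.closedBall (0 : ℝ) √(A * (T + T)))
    (isCompact_univ.prod (isCompact_closedBall _ _)) hT.le hτlim (u := u)
    (fun k t ht => by
      refine ⟨mem_univ _, ?_⟩
      rw [Metric.mem_closedBall, dist_comm]
      have hz : S k 0 = 0 := by simp [S, piecewiseConst_zero]
      rw [← hz]
      refine (hS k 0 h0 t ht).trans (Real.sqrt_le_sqrt ?_)
      rw [sub_zero, abs_of_nonneg ht.1]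
      have := hτT k
      gcongr
      exact ht.2)
    (fun k s hs t ht => max_le ((hyS k s t).trans (hS k s hs t ht)) (hS k s hs t ht))
  have hpt : ∀ t ∈ Icc 0 T, Tendsto (fun k => u (ψ k) t) atTop (𝓝 (g t)) := fun t ht =>
    Metric.tendsto_nhds.2 fun ε hε => (hg ε hε).mono fun k hk => hk t ht
  have hpt1 : ∀ t ∈ Icc 0 T, Tendsto (fun k => piecewiseConst (τ (ψ k)) (y (ψ k)) t) atTop
      (𝓝 (g t).1) := fun t ht => (hpt t ht).fst_nhds
  have hpt2 : ∀ t ∈ Icc 0 T, Tendsto (fun k => S (ψ k) t) atTop (𝓝 (g t).2) :=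
    fun t ht => (hpt t ht).snd_nhds
  have hτψ : Tendsto (fun k => τ (ψ k)) atTop (𝓝 0) := hτlim.comp hψ.tendsto_atTop
  have hgle : ∀ s ∈ Icc 0 T, ∀ t ∈ Icc 0 T, dist (g s).1 (g t).1 ≤ dist (g s).2 (g t).2 :=
    fun s hs t ht => le_of_tendsto_of_tendsto' ((hpt1 s hs).dist (hpt1 t ht))
      ((hpt2 s hs).dist (hpt2 t ht)) fun k => hyS _ s t
  refine ⟨ψ, hψ, fun t => (g t).1, fun ε hε => (hg ε hε).mono fun k hk t ht => ?_, ?_, ?_⟩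
  · exact (le_max_left _ _).trans_lt (hk t ht)
  · have hmono : ∀ s ∈ Icc 0 T, ∀ t ∈ Icc 0 T, s ≤ t → (g s).2 ≤ (g t).2 :=
      fun s hs t ht hst => le_of_tendsto_of_tendsto' (hpt2 s hs) (hpt2 t ht) fun k =>
        Finset.sum_le_sum_of_subset_of_nonneg (Finset.range_mono (Nat.sub_le_sub_right
          (Nat.ceil_mono (div_le_div_of_nonneg_right hst (hτpos _).le)) 1))
          fun _ _ _ => dist_nonneg
    have hac : AbsolutelyContinuousOnInterval (fun t => (g t).2) 0 T := by
      rw [absolutelyContinuousOnInterval_iff]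
      intro ε hε
      -- The family of intervals is fixed while `k` tends to infinity, so the errors `τ` disappear;
      -- `A + 1` avoids dividing by zero.
      refine ⟨ε ^ 2 / (A + 1), by positivity, fun E hE hlt => ?_⟩
      have hmem := hE.1
      rw [uIcc_of_le hT.le] at hmem
      have hle : ∑ i ∈ Finset.range E.1, dist (g (E.2 i).1).2 (g (E.2 i).2).2
          ≤ √(A * ∑ i ∈ Finset.range E.1, (|(E.2 i).2 - (E.2 i).1| + 0)) := by
        refine le_of_tendsto_of_tendsto' (tendsto_finsetSum _ fun i hi =>
          (hpt2 _ (hmem i hi).1).dist (hpt2 _ (hmem i hi).2))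
          (Real.continuous_sqrt.continuousAt.tendsto.comp
            (tendsto_const_nhds.mul (tendsto_finsetSum _ fun i _ =>
              tendsto_const_nhds.add hτψ))) fun k => ?_
        exact sum_dist_piecewiseConst_le (hτpos _) (hNτ _) (hy _) (fun _ => dist_nonneg) hE
      refine hle.trans_lt ((Real.sqrt_lt' hε).2 ?_)
      have e : ∑ i ∈ Finset.range E.1, (|(E.2 i).2 - (E.2 i).1| + 0)
          = ∑ i ∈ Finset.range E.1, dist (E.2 i).1 (E.2 i).2 :=
        Finset.sum_congr rfl fun i _ => by rw [add_zero, dist_comm, Real.dist_eq]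
      have hnn : 0 ≤ ∑ i ∈ Finset.range E.1, dist (E.2 i).1 (E.2 i).2 :=
        Finset.sum_nonneg fun _ _ => dist_nonneg
      rw [e]
      rw [lt_div_iff₀ (by positivity)] at hlt
      nlinarith
    refine ⟨deriv fun t => (g t).2, hac.intervalIntegrable_deriv, fun s t hs hst htT => ?_⟩
    have hsm : s ∈ Icc 0 T := ⟨hs, hst.trans htT⟩
    have htm : t ∈ Icc 0 T := ⟨hs.trans hst, htT⟩
    rw [(hac.mono (uIcc_subset_uIcc (by rwa [uIcc_of_le hT.le])
      (by rwa [uIcc_of_le hT.le]))).integral_deriv_eq_sub]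
    refine (hgle s hsm t htm).trans (le_of_eq ?_)
    rw [dist_comm, Real.dist_eq, abs_of_nonneg (sub_nonneg.2 (hmono s hsm t htm hst))]
  · intro s hs t ht
    refine (hgle s hs t ht).trans ?_
    have hlim : Tendsto (fun k => √(A * (|t - s| + τ (ψ k)))) atTop (𝓝 √(A * (|t - s| + 0))) :=
      Real.continuous_sqrt.continuousAt.tendsto.comp
        (tendsto_const_nhds.mul (tendsto_const_nhds.add hτψ))
    rw [add_zero, Real.sqrt_mul hA0] at hlim
    exact le_of_tendsto_of_tendsto' ((hpt2 s hs).dist (hpt2 t ht)) hlim fun k => hS _ s hs t ht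

end EVBDF2

/-! ### Discrete energy estimate and geodesic interpolation -/

namespace EVBDF2

variable {d : ℕ}

/-- One step of the scheme dissipates energy, up to a fraction of the preceding squared jump. -/
theorem IsSchemeSolution.step {Ω : Set (Space d)} {hΩ : IsCompact Ω} {𝓔 : POn Ω → EReal}
    {X : P2 d → P2 d → P2 d} {β τ θ : ℝ} {N : ℕ} {ρ : ℕ → POn Ω}
    (hρ : IsSchemeSolution hΩ 𝓔 X β τ N ρ) (hX : IsDissipative X θ) (hβ : β < 1) (hτ : 0 < τ)
    (h𝓔 : ∀ σ, 𝓔 σ ≠ ⊥) {n : ℕ} (hn : n + 2 ≤ N) (hfin : 𝓔 (ρ (n + 1)) ≠ ⊤) :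
    𝓔 (ρ (n + 2)) ≠ ⊤ ∧ W2 (ρ (n + 1)).1 (ρ (n + 2)).1 ^ 2 ≤
      4 * θ ^ 2 * W2 (ρ n).1 (ρ (n + 1)).1 ^ 2
        + 4 * (1 - β) * τ * ((𝓔 (ρ (n + 1))).toReal - (𝓔 (ρ (n + 2))).toReal) := by
  have hmin := hρ n hn (ρ (n + 1))
  obtain ⟨hθ, hX⟩ := hX
  have hdis := hX ((ρ n).toP2 hΩ) ((ρ (n + 1)).toP2 hΩ)
  have htri := W2_triangle ((ρ (n + 1)).toP2 hΩ) (X ((ρ n).toP2 hΩ) ((ρ (n + 1)).toP2 hΩ))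
    ((ρ (n + 2)).toP2 hΩ)
  rw [W2_comm (X _ _).1] at htri
  simp only [POn.toP2] at hmin hdis htri
  set x := X ⟨(ρ n).1, ((ρ n).toP2 hΩ).2⟩ ⟨(ρ (n + 1)).1, ((ρ (n + 1)).toP2 hΩ).2⟩
  have hh : 0 < 2 * (1 - β) * τ := by have := sub_pos.2 hβ; positivity
  have hfin2 : 𝓔 (ρ (n + 2)) ≠ ⊤ := by
    intro htop
    rw [htop, EReal.coe_add_top, top_le_iff] at hmin
    exact EReal.add_ne_top (EReal.coe_ne_top _) hfin hmin
  refine ⟨hfin2, ?_⟩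
  rw [← EReal.coe_toReal hfin (h𝓔 _), ← EReal.coe_toReal hfin2 (h𝓔 _), ← EReal.coe_add,
    ← EReal.coe_add, EReal.coe_le_coe_iff] at hmin
  set e₁ := (𝓔 (ρ (n + 1))).toReal
  set e₂ := (𝓔 (ρ (n + 2))).toReal
  set a := W2 (ρ (n + 2)).1 x.1
  set b := W2 (ρ (n + 1)).1 x.1
  set D := W2 (ρ n).1 (ρ (n + 1)).1
  have hb : 0 ≤ b := W2_nonneg _ _
  have hab : a ^ 2 ≤ b ^ 2 + 2 * (1 - β) * τ * (e₁ - e₂) := by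
    have h1 : a ^ 2 / (2 * (1 - β) * τ) ≤ b ^ 2 / (2 * (1 - β) * τ) + (e₁ - e₂) := by linarith
    rw [div_le_iff₀ hh, add_mul, div_mul_cancel₀ _ hh.ne'] at h1
    linarith
  have hbD : b ^ 2 ≤ θ ^ 2 * D ^ 2 := by
    rw [← mul_pow]
    exact pow_le_pow_left₀ hb hdis 2
  have hsq : W2 (ρ (n + 1)).1 (ρ (n + 2)).1 ^ 2 ≤ (b + a) ^ 2 :=
    pow_le_pow_left₀ (W2_nonneg _ _) htri 2
  -- `(a + b)² ≤ 2a² + 2b² ≤ 4b² + 4(1 - β)τ(e₁ - e₂)`, whence the factor `4θ²`.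
  nlinarith [sq_nonneg (a - b)]

/-- The discrete energy estimate. -/
theorem IsSchemeSolution.sum_sq_le {Ω : Set (Space d)} {hΩ : IsCompact Ω} {𝓔 : POn Ω → EReal}
    {X : P2 d → P2 d → P2 d} {β τ θ C : ℝ} {N : ℕ} {ρ : ℕ → POn Ω}
    (hρ : IsSchemeSolution hΩ 𝓔 X β τ N ρ) (hX : IsDissipative X θ) (hθ : θ < 1 / 2) (hβ : β < 1)
    (hτ : 0 < τ) (h𝓔 : ∀ σ, 𝓔 σ ≠ ⊥) {σ₀ : POn Ω} (hσ₀ : ∀ σ, 𝓔 σ₀ ≤ 𝓔 σ) (h0 : 𝓔 (ρ 0) ≠ ⊤)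
    (h01 : 𝓔 (ρ 1) ≤ 𝓔 (ρ 0)) (hC : W2 (ρ 0).1 (ρ 1).1 ^ 2 ≤ C * τ) (hN : 1 ≤ N) :
    ∑ i ∈ Finset.range N, W2 (ρ i).1 (ρ (i + 1)).1 ^ 2 ≤
      (C + 4 * (1 - β) * ((𝓔 (ρ 0)).toReal - (𝓔 σ₀).toReal)) / (1 - 4 * θ ^ 2) * τ := by
  have hθ2 : 0 < 1 - 4 * θ ^ 2 := by nlinarith [hX.1]
  have h1 : 𝓔 (ρ 1) ≠ ⊤ := ne_top_of_le_ne_top h0 h01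
  have hβ' : 0 < 1 - β := sub_pos.2 hβ
  -- The term `4θ²` times the last squared jump is what the next step consumes; this makes the
  -- induction telescope.
  have key : ∀ k, k + 1 ≤ N → 𝓔 (ρ (k + 1)) ≠ ⊤ ∧
      (1 - 4 * θ ^ 2) * ∑ i ∈ Finset.range (k + 1), W2 (ρ i).1 (ρ (i + 1)).1 ^ 2
        + 4 * θ ^ 2 * W2 (ρ k).1 (ρ (k + 1)).1 ^ 2 + 4 * (1 - β) * τ * (𝓔 (ρ (k + 1))).toReal
      ≤ C * τ + 4 * (1 - β) * τ * (𝓔 (ρ 1)).toReal := by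
    intro k
    induction k with
    | zero =>
      intro _
      refine ⟨h1, ?_⟩
      rw [zero_add, Finset.sum_range_one]
      linarith
    | succ k ih =>
      intro hk
      obtain ⟨hfin, hle⟩ := ih (by omega)
      obtain ⟨hfin2, hstep⟩ := hρ.step hX hβ hτ h𝓔 (n := k) hk hfin
      refine ⟨hfin2, ?_⟩
      rw [Finset.sum_range_succ]
      linarith
  obtain ⟨k, rfl⟩ : ∃ k, N = k + 1 := ⟨N - 1, by omega⟩
  obtain ⟨hfin, hle⟩ := key k le_rfl
  have e1 : (𝓔 (ρ 1)).toReal ≤ (𝓔 (ρ 0)).toReal := EReal.toReal_le_toReal h01 (h𝓔 _) h0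
  have e2 : (𝓔 σ₀).toReal ≤ (𝓔 (ρ (k + 1))).toReal := EReal.toReal_le_toReal (hσ₀ _) (h𝓔 _) hfin
  rw [div_mul_eq_mul_div, le_div_iff₀ hθ2]
  have e3 : 4 * (1 - β) * τ * (𝓔 (ρ 1)).toReal ≤ 4 * (1 - β) * τ * (𝓔 (ρ 0)).toReal := by gcongr
  have e4 : 4 * (1 - β) * τ * (𝓔 σ₀).toReal ≤ 4 * (1 - β) * τ * (𝓔 (ρ (k + 1))).toReal := by gcongr
  have e5 : 0 ≤ 4 * θ ^ 2 * W2 (ρ k).1 (ρ (k + 1)).1 ^ 2 := by positivity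
  linarith

/-- The distance between the piecewise constant and a piecewise geodesic interpolation is controlled
by the size of the jumps. -/
theorem IsGeodesicInterpolation.W2_piecewiseConst_le {Ω : Set (Space d)} {hΩ : IsCompact Ω}
    {τ T r : ℝ} {N : ℕ} {ρ : ℕ → POn Ω} {ω : ℝ → P2 d}
    (hω : IsGeodesicInterpolation τ N (fun n => (ρ n).toP2 hΩ) ω) (hτ : 0 < τ) (hN : 1 ≤ N)
    (hNτ : N * τ = T) (hr : ∀ n < N, W2 (ρ n).1 (ρ (n + 1)).1 ≤ r) {t : ℝ} (ht : t ∈ Icc 0 T) :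
    W2 (piecewiseConst τ ρ t).1 (ω t).1 ≤ r := by
  rcases ht.1.eq_or_lt with rfl | ht0
  · have h := (hω 0 hN).1
    rw [Nat.cast_zero, zero_mul] at h
    rw [piecewiseConst_zero, h]
    exact (W2_self (ρ 0).1).trans_le ((W2_nonneg _ _).trans (hr 0 hN))
  · have hpos : 0 < ⌈t / τ⌉₊ := Nat.ceil_pos.2 (div_pos ht0 hτ)
    obtain ⟨n, hn⟩ : ∃ n, ⌈t / τ⌉₊ = n + 1 := ⟨⌈t / τ⌉₊ - 1, by omega⟩
    obtain ⟨h1, h2⟩ := (Nat.ceil_eq_iff (Nat.succ_ne_zero n)).1 hn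
    rw [lt_div_iff₀ hτ] at h1
    rw [div_le_iff₀ hτ] at h2
    have htn : t ∈ Ioc (n * τ) ((n + 1) * τ) := ⟨by simpa using h1, by simpa using h2⟩
    have hnN : n < N := by
      have : (n : ℝ) * τ < N * τ := htn.1.trans_le (hNτ ▸ ht.2)
      exact_mod_cast (mul_lt_mul_iff_left₀ hτ).1 this
    obtain ⟨g0, g1, g2⟩ := hω n hnN
    have hg := g2 (n * τ) (left_mem_Icc.2 (htn.1.le.trans htn.2)) t (Ioc_subset_Icc_self htn)
    rw [g0, g1] at hg
    rw [piecewiseConst_of_mem hτ ρ n htn]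
    refine (le_of_eq hg).trans ((mul_le_of_le_one_left (W2_nonneg _ _) ?_).trans (hr n hnN))
    have hlen : 0 < (n + 1) * τ - n * τ := by linarith
    rw [abs_of_pos hlen, abs_of_pos (sub_pos.2 htn.1), div_le_one hlen]
    linarith [htn.2]

end EVBDF2

/-! ### Assembly -/

theorem mainTheorem6 {d : ℕ} {Ω : Set (EVBDF2.Space d)} (hΩ : IsCompact Ω)
    (hconv : Convex ℝ Ω)
    (𝓔 : EVBDF2.POn Ω → EReal) (h𝓔_lsc : LowerSemicontinuous 𝓔) (h𝓔_bot : ∀ σ, 𝓔 σ ≠ ⊥)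
    (ρ₀ : EVBDF2.POn Ω) (h𝓔_fin : 𝓔 ρ₀ ≠ ⊤)
    (β θ C : ℝ) (hβ0 : 0 ≤ β) (hβ1 : β < 1) (hθ : θ < 1 / 2) (hC : 0 < C) :
    -- the constant `K` depends only on `Ω`, `𝓔`, `ρ₀`, `β`, `θ` and `C`
    ∃ K : ℝ, ∀ (T : ℝ), 0 < T →
      ∀ (X : EVBDF2.P2 d → EVBDF2.P2 d → EVBDF2.P2 d), EVBDF2.IsDissipative X θ →
      -- `ρ N 0, …, ρ N N` is the discrete solution with time step `T / N`
      ∀ (ρ : ℕ → ℕ → EVBDF2.POn Ω),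
        (∀ N : ℕ, 1 ≤ N →
          ρ N 0 = ρ₀ ∧
          EVBDF2.W2 ρ₀.1 (ρ N 1).1 ^ 2 ≤ C * (T / N) ∧
          𝓔 (ρ N 1) ≤ 𝓔 ρ₀ ∧
          EVBDF2.IsSchemeSolution hΩ 𝓔 X β (T / N) N (ρ N)) →
        -- every subsequence has a uniformly convergent further subsequence
        (∀ φ : ℕ → ℕ, StrictMono φ →
          ∃ ψ : ℕ → ℕ, StrictMono ψ ∧ ∃ ϱ : ℝ → EVBDF2.POn Ω,
            (∀ ε : ℝ, 0 < ε → ∀ᶠ k in Filter.atTop, ∀ t ∈ Set.Icc (0 : ℝ) T,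
              EVBDF2.W2
                (EVBDF2.piecewiseConst (T / (φ (ψ k) : ℝ)) (ρ (φ (ψ k))) t).1 (ϱ t).1 < ε) ∧
            EVBDF2.IsAbsolutelyContinuousCurve T ϱ ∧
            (∀ s ∈ Set.Icc (0 : ℝ) T, ∀ t ∈ Set.Icc (0 : ℝ) T,
              EVBDF2.W2 (ϱ s).1 (ϱ t).1 ≤ K * Real.sqrt |t - s|)) ∧
        -- distance between the piecewise constant curve and any geodesic interpolation
        (∀ N : ℕ, 1 ≤ N → ∀ ω : ℝ → EVBDF2.P2 d,
          EVBDF2.IsGeodesicInterpolation (T / N) N (fun n => (ρ N n).toP2 hΩ) ω →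
          ∀ t ∈ Set.Icc (0 : ℝ) T,
            EVBDF2.W2 (EVBDF2.piecewiseConst (T / N) (ρ N) t).1 (ω t).1
              ≤ K * Real.sqrt (T / N)) := by
  have := EVBDF2.compactSpace_POn hΩ
  obtain ⟨σ₀, -, hσ₀⟩ := LowerSemicontinuousOn.exists_isMinOn (s := univ) ⟨ρ₀, mem_univ _⟩
    isCompact_univ (h𝓔_lsc.lowerSemicontinuousOn univ)
  rw [isMinOn_univ_iff] at hσ₀
  set A := (C + 4 * (1 - β) * ((𝓔 ρ₀).toReal - (𝓔 σ₀).toReal)) / (1 - 4 * θ ^ 2)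
  refine ⟨√A, fun T hT X hX ρ hρ => ?_⟩
  have hsum : ∀ N, 1 ≤ N →
      ∑ i ∈ Finset.range N, EVBDF2.W2 (ρ N i).1 (ρ N (i + 1)).1 ^ 2 ≤ A * (T / N) := by
    intro N hN
    obtain ⟨h0, h1, h2, h3⟩ := hρ N hN
    have h := h3.sum_sq_le hX hθ hβ1 (div_pos hT (Nat.cast_pos.2 hN)) h𝓔_bot hσ₀ (h0 ▸ h𝓔_fin)
      (h0 ▸ h2) (h0 ▸ h1) hN
    rwa [h0] at h
  have hA : 0 ≤ A := by
    have h := (Finset.sum_nonneg fun i _ => sq_nonneg _).trans (hsum 1 le_rfl)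
    exact nonneg_of_mul_nonneg_left h (by simpa using hT)
  constructor
  · intro φ hφ
    let _ := EVBDF2.wassersteinPseudoMetricSpace hΩ
    have := EVBDF2.compactSpace_wassersteinSpace hΩ
    -- The index is shifted because `φ 0` may be `0`, where the scheme gives no information.
    have hφpos : ∀ k, 0 < φ (k + 1) := fun k => (Nat.succ_pos k).trans_le (hφ.id_le _)
    obtain ⟨ψ, hψ, g, hg⟩ := EVBDF2.exists_subseq_piecewiseConst
      (Y := EVBDF2.WassersteinSpace Ω) (A := A) hT (fun k => φ (k + 1)) hφpos
      (hφ.tendsto_atTop.comp (tendsto_add_atTop_nat 1)) (fun k => ρ (φ (k + 1)))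
      fun k => hsum _ (hφpos k)
    exact ⟨fun k => ψ k + 1, fun a b hab => Nat.succ_lt_succ (hψ hab), g, hg⟩
  · intro N hN ω hω t ht
    have hτ : 0 < T / N := div_pos hT (Nat.cast_pos.2 hN)
    refine hω.W2_piecewiseConst_le hτ hN
      (mul_div_cancel₀ T (Nat.cast_ne_zero.2 (Nat.pos_iff_ne_zero.1 hN))) (fun n hn => ?_) ht
    rw [← Real.sqrt_mul hA]
    exact Real.le_sqrt_of_sq_le ((Finset.single_le_sum
      (f := fun i => EVBDF2.W2 (ρ N i).1 (ρ N (i + 1)).1 ^ 2) (fun i _ => sq_nonneg _)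
      (Finset.mem_range.2 hn)).trans (hsum N hN))
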